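/- **Setting.** Let $\mathcal H$ be a complex Hilbert space. A symmetry type $\mathsf S$ of the tenfold way is one of $\{\mathbb 1\}$, $\{\mathbb 1,\eta\}$, $\{\mathbb 1,\tau\}$, $\{\mathbb 1,\gamma\}$, $\{\mathbb 1,\eta,\tau,\gamma\}$, together with a sign for the square of each of $\eta,\tau$ that is present. A representation $\rho$ of $\mathsf S$ on $\mathcal H$ consists of antiunitaries $\eta$ (particle-hole) and $\tau$ (time-reversal) with $\eta^2=\pm\mathbb 1$, $\tau^2=\pm\mathbb 1$ as prescribed, and a unitary $\gamma$ (chiral), for the symmetries that are present; $\gamma^2=\mathbb 1$ if $\gamma$ is the only one, and $\eta\tau=\tau\eta=\gamma$ if all three are present. For $\dim\mathcal H<\infty$ the symmetry index of $\rho$ is $$ \operatorname{si}(\rho)=\begin{cases} \dim\mathcal H \bmod 2 & \mathsf S=\{\mathbb 1,\eta\},\ \eta^2=\mathbb 1,\\ \dim\mathcal H \bmod 4 & \mathsf S=\{\mathbb 1,\eta,\tau,\gamma\},\ \eta^2=\mathbb 1,\ \tau^2=-\mathbb 1,\\ \operatorname{tr}\gamma & \mathsf S=\{\mathbb 1,\gamma\}\text{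 or }\{\mathbb 1,\eta,\tau,\gamma\},\ \eta^2=\tau^2,\\ 0 & \text{otherwise.} \end{cases} $$ A unitary $W$ satisfies the symmetries in $\rho$ if $\eta W\eta^*=W$, $\tau W\tau^*=W^*$, $\gamma W\gamma^*=W^*$ for the symmetries present; $W$ is admissible for $\rho$ if, moreover, it is essentially gapped at $\pm1$, i.e. in a neighbourhood of $1$ and of $-1$ the spectrum of $W$ consists only of isolated eigenvalues of finite multiplicity. If $W$ satisfies the symmetries in $\rho$, its $\pm1$-eigenspaces are invariant under the symmetries, and, when they are finite-dimensional, $\operatorname{si}_\pm(W)=\operatorname{si}(\rho_\pm)$ with $\rho_\pm$ the representation induced by $\rho$ on the $\pm1$-eigenspace. A subspace $\mathcal H_C\subset\mathcal H$ is $\rho$-invariant if it is invariant under every symmetry in $\rho$ (then $\rho_C=\rho\upharpoonright\mathcal H_C$ is the induced representation of $\mathsf S$), and cyclic for $W$ if $\overline{\sum_{n\in\mathbb Z}W^n\mathcal H_C}=\mathcal H$. With $P_C$ the orthogonal projection onto $\mathcal H_C$ and $P_C^\perp=\mathbb 1-P_C$, the Schur function of $\mathcal H_C$ is the function $$f(z)=P_C(W-zP_C^\perp)^{-1}P_C,\qquad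 |z|<1,$$ with values operators on $\mathcal H_C$. For $z\neq0$ it equals $z^{-1}(F(z)-\mathbb 1)(F(z)+\mathbb 1)^{-1}$, where $F(z)=\int\frac{t+z}{t-z}\,d\mu(t)$ and $\mu=P_CEP_C$ is the compression to $\mathcal H_C$ of the spectral measure $E$ of $W$. The value of $f$ at $\pm1$ is that of its analytic continuation. **Theorem.** Let $W$ be an admissible unitary for a representation $\rho$ of a symmetry type $\mathsf S$ on $\mathcal H$, let $\mathcal H_C$ be a finite-dimensional, $\rho$-invariant subspace that is cyclic for $W$, and let $f$ be the Schur function of $\mathcal H_C$. Then $f$ has an analytic continuation from the unit disk to neighbourhoods of $1$ and of $-1$, and, for each of the two choices of sign (the same throughout): (i) $\pm1$ is an eigenvalue of $W$ if and only if $\pm1$ is an eigenvalue of $f(\pm1)$; (ii) $f(\pm1)$ is a unitary on $\mathcal H_C$ which satisfies the symmetries in the representation $\rho_C=\rho\upharpoonright\mathcal H_C$ of the same symmetry type $\mathsf S$, and $$\operatorname{si}_\pm(W)=\operatorname{si}_\pm(f(\pm1)),$$ where $\operatorname{si}_\pm(f(\pm1))$ is the index of the representation induced by $\rho_C$ on the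 $\pm1$-eigenspace of $f(\pm1)$. -/

import Mathlib

open Topology

noncomputable section

/-! ## Symmetry types of the tenfold way and their representations -/

/-- A sign, `+` or `-`. -/
inductive Sign : Type
  | plus
  | minus

/-- The complex number `1` or `-1`. -/
def Sign.toComplex : Sign → ℂ
  | .plus => 1
  | .minus => -1

/-- The ten symmetry types: the symmetries that are present, together with the signs of the
squares of the antiunitary ones. -/
inductive SymType : Type
  /-- `{1}` -/
  | trivial
  /-- `{1, η}` with `η² = εη` -/
  | particleHole (εη : Sign)
  /-- `{1, τ}` with `τ² = ετ` -/
  | timeReversal (ετ : Sign)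
  /-- `{1, γ}` with `γ² = 1` -/
  | chiral
  /-- `{1, η, τ, γ}` with `η² = εη`, `τ² = ετ`, `ητ = τη` and `γ = ητ` -/
  | full (εη ετ : Sign)

section

variable {E : Type*} [NormedAddCommGroup E] [InnerProductSpace ℂ E]

/-- A representation of a symmetry type on an inner product space `E`. The particle-hole symmetry
`η` and the time-reversal symmetry `τ` are antiunitary, the chiral symmetry `γ` is unitary; if all
of them are present, then `γ = ητ` (so that it need not be given separately). -/
inductive SymRep (E : Type*) [NormedAddCommGroup E] [InnerProductSpace ℂ E] : SymType → Type _
  | trivial : SymRep E .trivial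
  | particleHole (εη : Sign) (η : E ≃ₗᵢ⋆[ℂ] E) (hη : ∀ x, η (η x) = εη.toComplex • x) :
      SymRep E (.particleHole εη)
  | timeReversal (ετ : Sign) (τ : E ≃ₗᵢ⋆[ℂ] E) (hτ : ∀ x, τ (τ x) = ετ.toComplex • x) :
      SymRep E (.timeReversal ετ)
  | chiral (γ : E ≃ₗᵢ[ℂ] E) (hγ : ∀ x, γ (γ x) = x) : SymRep E .chiral
  | full (εη ετ : Sign) (η τ : E ≃ₗᵢ⋆[ℂ] E) (hη : ∀ x, η (η x) = εη.toComplex • x)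
      (hτ : ∀ x, τ (τ x) = ετ.toComplex • x) (hc : ∀ x, η (τ x) = τ (η x)) :
      SymRep E (.full εη ετ)

namespace SymRep

variable {S : SymType}

/-- A subspace is `ρ`-invariant if it is invariant under every symmetry in `ρ`. -/
def Invariant : {S : SymType} → SymRep E S → Submodule ℂ E → Prop
  | _, .trivial, _ => True
  | _, .particleHole _ η _, K => ∀ x ∈ K, η x ∈ K
  | _, .timeReversal _ τ _, K => ∀ x ∈ K, τ x ∈ K
  | _, .chiral γ _, K => ∀ x ∈ K, γ x ∈ K
  | _, .full _ _ η τ _ _ _, K =>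
      (∀ x ∈ K, η x ∈ K) ∧ (∀ x ∈ K, τ x ∈ K) ∧ (∀ x ∈ K, η (τ x) ∈ K)

/-- The unitary `W` satisfies the symmetries in `ρ`: `η W η* = W`, `τ W τ* = W*`, `γ W γ* = W*`
for the symmetries that are present. The adjoint `σ*` of a unitary or antiunitary `σ` is its
inverse. -/
def IsSymmetryOf [CompleteSpace E] : {S : SymType} → SymRep E S → unitary (E →L[ℂ] E) → Prop
  | _, .trivial, _ => True
  | _, .particleHole _ η _, W => ∀ x, η ((W : E →L[ℂ] E) (η.symm x)) = (W : E →L[ℂ] E) x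
  | _, .timeReversal _ τ _, W => ∀ x, τ ((W : E →L[ℂ] E) (τ.symm x)) = star (W : E →L[ℂ] E) x
  | _, .chiral γ _, W => ∀ x, γ ((W : E →L[ℂ] E) (γ.symm x)) = star (W : E →L[ℂ] E) x
  | _, .full _ _ η τ _ _ _, W =>
      (∀ x, η ((W : E →L[ℂ] E) (η.symm x)) = (W : E →L[ℂ] E) x) ∧
      (∀ x, τ ((W : E →L[ℂ] E) (τ.symm x)) = star (W : E →L[ℂ] E) x) ∧
      (∀ x, (τ.trans η : E ≃ₗᵢ[ℂ] E) ((W : E →L[ℂ] E) ((τ.trans η : E ≃ₗᵢ[ℂ] E).symm x)) =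
        star (W : E →L[ℂ] E) x)

end SymRep

theorem Sign.toComplex_mul_self (s : Sign) : s.toComplex * s.toComplex = 1 := by
  cases s <;> simp [Sign.toComplex]

theorem Sign.toComplex_ne_zero (s : Sign) : s.toComplex ≠ 0 := by
  cases s <;> simp [Sign.toComplex]

theorem Sign.conj_toComplex (s : Sign) : starRingEnd ℂ s.toComplex = s.toComplex := by
  cases s <;> simp [Sign.toComplex]

/-- The restriction of a unitary or antiunitary involution (up to sign) to an invariant
subspace. -/
def restrictInvolution {φ : ℂ →+* ℂ} [RingHomInvPair φ φ] (σ : E ≃ₛₗᵢ[φ] E) (s : Sign)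
    (hσ : ∀ x, σ (σ x) = s.toComplex • x) (K : Submodule ℂ E) (hK : ∀ x ∈ K, σ x ∈ K) :
    K ≃ₛₗᵢ[φ] K where
  toFun x := ⟨σ x, hK x x.2⟩
  invFun x := ⟨σ.symm x, by
    have h : σ.symm (x : E) = φ s.toComplex • σ (x : E) := by
      apply σ.injective
      rw [map_smulₛₗ, hσ, RingHomInvPair.comp_apply_eq, smul_smul, s.toComplex_mul_self,
        one_smul, LinearIsometryEquiv.apply_symm_apply]
    rw [h]
    exact K.smul_mem _ (hK x x.2)⟩
  left_inv x := by simp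
  right_inv x := by simp
  map_add' x y := by ext; simp
  map_smul' c x := by ext; simp [map_smulₛₗ]
  norm_map' x := by simp

@[simp] theorem restrictInvolution_coe {φ : ℂ →+* ℂ} [RingHomInvPair φ φ] (σ : E ≃ₛₗᵢ[φ] E)
    (s : Sign) (hσ : ∀ x, σ (σ x) = s.toComplex • x) (K : Submodule ℂ E)
    (hK : ∀ x ∈ K, σ x ∈ K) (x : K) :
    (restrictInvolution σ s hσ K hK x : E) = σ x := rfl

namespace SymRep

variable {S : SymType}

/-- The representation of the symmetry type induced on an invariant subspace, constituted by the
restrictions of the symmetries. -/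
def restrict : {S : SymType} → (ρ : SymRep E S) → (K : Submodule ℂ E) → ρ.Invariant K → SymRep K S
  | _, .trivial, _, _ => .trivial
  | _, .particleHole s η hη, K, hK =>
      .particleHole s (restrictInvolution η s hη K hK) fun x =>
        Subtype.ext (hη x)
  | _, .timeReversal s τ hτ, K, hK =>
      .timeReversal s (restrictInvolution τ s hτ K hK) fun x =>
        Subtype.ext (hτ x)
  | _, .chiral γ hγ, K, hK =>
      .chiral (restrictInvolution γ .plus (by simpa [Sign.toComplex] using hγ) K hK) fun x =>
        Subtype.ext (hγ x)
  | _, .full s t η τ hη hτ hc, K, hK =>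
      .full s t (restrictInvolution η s hη K hK.1) (restrictInvolution τ t hτ K hK.2.1)
        (fun x => Subtype.ext (hη x)) (fun x => Subtype.ext (hτ x)) (fun x => Subtype.ext (hc x))

end SymRep

/-- The group in which the symmetry index takes its values: `ℤ/2`, `ℤ/4`, the additive group of
`ℂ`, or the trivial group. (Where the value is a trace it is in fact an integer, because `γ² = 1`
in these cases.) -/
def SymType.IndexGroup : SymType → Type
  | .particleHole .plus => ZMod 2
  | .full .plus .minus => ZMod 4
  | .chiral => ℂ
  | .full .plus .plus => ℂ
  | .full .minus .minus => ℂ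
  | .trivial => Unit
  | .particleHole .minus => Unit
  | .timeReversal _ => Unit
  | .full .minus .plus => Unit

/-- The symmetry index `si(ρ)` of a representation on a finite-dimensional space: `dim E mod 2` for
`{1, η}` with `η² = 1`; `dim E mod 4` for `{1, η, τ, γ}` with `η² = 1`, `τ² = -1`; `tr γ` for
`{1, γ}` and for `{1, η, τ, γ}` with `η² = τ²`; zero otherwise. -/
def SymRep.index : {S : SymType} → SymRep E S → S.IndexGroup
  | _, .particleHole .plus _ _ => (Module.finrank ℂ E : ZMod 2)
  | _, .full .plus .minus _ _ _ _ _ => (Module.finrank ℂ E : ZMod 4)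
  | _, .chiral γ _ => LinearMap.trace ℂ E γ.toLinearEquiv.toLinearMap
  | _, .full .plus .plus η τ _ _ _ =>
      LinearMap.trace ℂ E (τ.trans η : E ≃ₗᵢ[ℂ] E).toLinearEquiv.toLinearMap
  | _, .full .minus .minus η τ _ _ _ =>
      LinearMap.trace ℂ E (τ.trans η : E ≃ₗᵢ[ℂ] E).toLinearEquiv.toLinearMap
  | _, .trivial => ()
  | _, .particleHole .minus _ _ => ()
  | _, .timeReversal _ _ _ => ()
  | _, .full .minus .plus _ _ _ _ _ => ()

/-- The `z`-eigenspace of a bounded operator. -/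
abbrev eigSpace (A : E →L[ℂ] E) (z : ℂ) : Submodule ℂ E :=
  Module.End.eigenspace (A : E →ₗ[ℂ] E) z

/-- `z` is an eigenvalue of the bounded operator `A`. -/
abbrev IsEigenvalue (A : E →L[ℂ] E) (z : ℂ) : Prop :=
  Module.End.HasEigenvalue (A : E →ₗ[ℂ] E) z

theorem star_apply_of_eig [CompleteSpace E] (W : unitary (E →L[ℂ] E)) (s : Sign) (x : E) :
    star (W : E →L[ℂ] E) x = s.toComplex • x ↔ (W : E →L[ℂ] E) x = s.toComplex • x := by
  have h1 : ∀ y, star (W : E →L[ℂ] E) ((W : E →L[ℂ] E) y) = y := fun y => by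
    rw [← mul_apply_eq_comp, Unitary.star_mul_self_of_mem W.2]; rfl
  have h2 : ∀ y, (W : E →L[ℂ] E) (star (W : E →L[ℂ] E) y) = y := fun y => by
    rw [← mul_apply_eq_comp, Unitary.mul_star_self_of_mem W.2]; rfl
  constructor
  · intro h
    have := h2 x
    rw [h, map_smul] at this
    conv_rhs => rw [← this]
    rw [smul_smul, s.toComplex_mul_self, one_smul]
  · intro h
    have := h1 x
    rw [h, map_smul] at this
    conv_rhs => rw [← this]
    rw [smul_smul, s.toComplex_mul_self, one_smul]

/-- The `±1`-eigenspaces of a unitary are invariant under its symmetries. -/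
theorem SymRep.invariant_eigSpace [CompleteSpace E] {S : SymType} (ρ : SymRep E S)
    (W : unitary (E →L[ℂ] E)) (hW : ρ.IsSymmetryOf W) (s : Sign) :
    ρ.Invariant (eigSpace (W : E →L[ℂ] E) s.toComplex) := by
  have hph : ∀ η : E ≃ₗᵢ⋆[ℂ] E,
      (∀ x, η ((W : E →L[ℂ] E) (η.symm x)) = (W : E →L[ℂ] E) x) →
      ∀ x ∈ eigSpace (W : E →L[ℂ] E) s.toComplex,
        η x ∈ eigSpace (W : E →L[ℂ] E) s.toComplex := by
    intro η h x hx
    rw [Module.End.mem_eigenspace_iff, ContinuousLinearMap.coe_coe] at hx ⊢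
    rw [← h, LinearIsometryEquiv.symm_apply_apply, hx, map_smulₛₗ, s.conj_toComplex]
  have htr : ∀ τ : E ≃ₗᵢ⋆[ℂ] E,
      (∀ x, τ ((W : E →L[ℂ] E) (τ.symm x)) = star (W : E →L[ℂ] E) x) →
      ∀ x ∈ eigSpace (W : E →L[ℂ] E) s.toComplex,
        τ x ∈ eigSpace (W : E →L[ℂ] E) s.toComplex := by
    intro τ h x hx
    rw [Module.End.mem_eigenspace_iff, ContinuousLinearMap.coe_coe] at hx ⊢
    rw [← star_apply_of_eig, ← h, LinearIsometryEquiv.symm_apply_apply, hx, map_smulₛₗ,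
      s.conj_toComplex]
  have hch : ∀ γ : E ≃ₗᵢ[ℂ] E,
      (∀ x, γ ((W : E →L[ℂ] E) (γ.symm x)) = star (W : E →L[ℂ] E) x) →
      ∀ x ∈ eigSpace (W : E →L[ℂ] E) s.toComplex,
        γ x ∈ eigSpace (W : E →L[ℂ] E) s.toComplex := by
    intro γ h x hx
    rw [Module.End.mem_eigenspace_iff, ContinuousLinearMap.coe_coe] at hx ⊢
    rw [← star_apply_of_eig, ← h, LinearIsometryEquiv.symm_apply_apply, hx, map_smul]
  cases ρ with
  | trivial => exact True.intro
  | particleHole _ η _ => exact hph η hW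
  | timeReversal _ τ _ => exact htr τ hW
  | chiral γ _ => exact hch γ hW
  | full _ _ η τ _ _ _ => exact ⟨hph η hW.1, htr τ hW.2.1, hch _ hW.2.2⟩

/-- The index `si_±(W) = si(ρ_±)` of a unitary `W` with the symmetries `ρ`, where `ρ_±` is the
representation induced by `ρ` on the `±1`-eigenspace of `W`. -/
def siPM [CompleteSpace E] {S : SymType} (ρ : SymRep E S) (W : unitary (E →L[ℂ] E))
    (hW : ρ.IsSymmetryOf W) (s : Sign) : S.IndexGroup :=
  (ρ.restrict (eigSpace (W : E →L[ℂ] E) s.toComplex) (ρ.invariant_eigSpace W hW s)).index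

/-- The essential spectrum of `A` has a gap around `z₀`: near `z₀`, the spectrum consists only of
isolated eigenvalues of finite multiplicity. -/
def IsEssentiallyGappedAt (A : E →L[ℂ] E) (z₀ : ℂ) : Prop :=
  ∃ r > 0, ∀ z ∈ spectrum ℂ A, z ∈ Metric.ball z₀ r →
    ¬ AccPt z (Filter.principal (spectrum ℂ A)) ∧ IsEigenvalue A z ∧
      FiniteDimensional ℂ (eigSpace A z)

/-- `W` is an admissible unitary for the representation `ρ`: it has the symmetries in `ρ` and it is
essentially gapped around `1` and `-1`. -/
structure IsAdmissible [CompleteSpace E] {S : SymType} (ρ : SymRep E S)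
    (W : unitary (E →L[ℂ] E)) : Prop where
  symmetric : ρ.IsSymmetryOf W
  gapped : ∀ s : Sign, IsEssentiallyGappedAt (W : E →L[ℂ] E) s.toComplex

/-- A subspace `K` is cyclic for `W` if the closure of `∑_{n ∈ ℤ} Wⁿ K` is the whole space. -/
def IsCyclicFor [CompleteSpace E] (W : unitary (E →L[ℂ] E)) (K : Submodule ℂ E) : Prop :=
  (⨆ n : ℤ, K.map (((W ^ n : unitary (E →L[ℂ] E)) : E →L[ℂ] E) : E →ₗ[ℂ] E)).topologicalClosure = ⊤

/-! ## Schur functions -/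

/-- The compression `P A P` of a bounded operator `A`, as an operator on `K`, where `P` is the
orthogonal projection onto `K`. -/
def compression (K : Submodule ℂ E) [K.HasOrthogonalProjection] (A : E →L[ℂ] E) : K →L[ℂ] K :=
  K.orthogonalProjectionOnto ∘L A ∘L K.subtypeL

/-- The Schur function `f(z) = P (W - z P^⊥)⁻¹ P` of the subspace `K`, where `P` is the orthogonal
projection onto `K` and `|z| < 1`. Its values are operators on `K`. -/
def schurFunction [CompleteSpace E] (W : unitary (E →L[ℂ] E)) (K : Submodule ℂ E)
    [K.HasOrthogonalProjection] (z : ℂ) : K →L[ℂ] K :=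
  compression K (Ring.inverse ((W : E →L[ℂ] E) - z • (1 - K.starProjection)))

/-- The Carathéodory function `F(z) = ∫ (t + z) / (t - z) dμ(t)`, `|z| < 1`, of the spectral
measure `μ = P E P` of the subspace `K`, where `E` is the spectral measure of `W`. The integral
against `E` is written with the continuous functional calculus of `W`. -/
def caratheodoryFunction [CompleteSpace E] (W : unitary (E →L[ℂ] E)) (K : Submodule ℂ E)
    [K.HasOrthogonalProjection] (z : ℂ) : K →L[ℂ] K :=
  compression K (cfc (fun t : ℂ => (t + z) / (t - z)) (W : E →L[ℂ] E))

/-- An operator whose distance from a unitary is less than one is invertible. -/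
theorem isUnit_unitary_sub [CompleteSpace E] (W : unitary (E →L[ℂ] E)) (B : E →L[ℂ] E)
    (hB : ‖B‖ < 1) : IsUnit ((W : E →L[ℂ] E) - B) := by
  have h : (W : E →L[ℂ] E) - B = (W : E →L[ℂ] E) * (1 - star (W : E →L[ℂ] E) * B) := by
    rw [mul_sub, ← mul_assoc, Unitary.mul_star_self_of_mem W.2, mul_one, one_mul]
  rw [h]
  refine (Unitary.toUnits W).isUnit.mul (isUnit_one_sub_of_norm_lt_one ?_)
  refine lt_of_le_of_lt ?_ hB
  have := CStarRing.norm_coe_unitary_mul (star W) B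
  exact this.le

theorem schur_algebra {R : Type*} [Ring R] [Algebra ℂ R] (a b : R) (z : ℂ) (hz0 : z ≠ 0)
    (e1 : b = a + z • (a * b)) (e2 : b = a + z • (b * a)) :
    IsUnit (1 + (2 * z) • b + 1) ∧
      a = z⁻¹ • ((1 + (2 * z) • b - 1) * Ring.inverse (1 + (2 * z) • b + 1)) := by
  have hF1 : 1 + (2 * z) • b + 1 = (2 : ℂ) • (1 + z • b) := by
    rw [smul_add, smul_smul, two_smul]; abel
  have m1 : (1 - z • a) * (1 + z • b) = 1 := by
    have : (1 - z • a) * (1 + z • b) = 1 + z • (b - (a + z • (a * b))) := by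
      simp only [sub_mul, mul_add, one_mul, mul_one, smul_mul_assoc, mul_smul_comm, smul_sub,
        smul_add]
      abel
    rw [this, ← e1, sub_self, smul_zero, add_zero]
  have m2 : (1 + z • b) * (1 - z • a) = 1 := by
    have : (1 + z • b) * (1 - z • a) = 1 + z • (b - (a + z • (b * a))) := by
      simp only [add_mul, mul_sub, one_mul, mul_one, smul_mul_assoc, mul_smul_comm, smul_sub,
        smul_add]
      abel
    rw [this, ← e2, sub_self, smul_zero, add_zero]
  let u : Rˣ :=
    ⟨(2 : ℂ) • (1 + z • b), (2 : ℂ)⁻¹ • (1 - z • a),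
      by rw [smul_mul_smul_comm, m2]; simp, by rw [smul_mul_smul_comm, m1]; simp⟩
  have hu : 1 + (2 * z) • b + 1 = (u : R) := hF1
  have hinv : Ring.inverse (1 + (2 * z) • b + 1) = (2 : ℂ)⁻¹ • (1 - z • a) := by
    rw [hu, Ring.inverse_unit]; rfl
  refine ⟨hu ▸ u.isUnit, ?_⟩
  rw [hinv, add_sub_cancel_left, smul_mul_smul_comm, smul_smul]
  have : z⁻¹ * (2 * z * 2⁻¹) = 1 := by field_simp
  rw [this, one_smul, mul_sub, mul_one, mul_smul_comm]
  exact eq_sub_of_add_eq e2.symm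

/-- The Schur function and the Carathéodory function of a subspace are related by
`f = z⁻¹ (F - 1) (F + 1)⁻¹`. -/
theorem schurFunction_eq [CompleteSpace E] (W : unitary (E →L[ℂ] E)) (K : Submodule ℂ E)
    [K.HasOrthogonalProjection] (z : ℂ) (hz : ‖z‖ < 1) (hz0 : z ≠ 0) :
    IsUnit (caratheodoryFunction W K z + 1) ∧
      schurFunction W K z =
        z⁻¹ • ((caratheodoryFunction W K z - 1) * Ring.inverse (caratheodoryFunction W K z + 1)) := by
  have hn : IsStarNormal (W : E →L[ℂ] E) := inferInstance
  have hsp : ∀ t ∈ spectrum ℂ (W : E →L[ℂ] E), t - z ≠ 0 := by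
    intro t ht h
    have h1 := spectrum.subset_circle_of_unitary W.2 ht
    rw [sub_eq_zero] at h
    rw [h, mem_sphere_zero_iff_norm] at h1
    exact hz.ne h1
  have hci : ContinuousOn (fun t : ℂ => (t - z)⁻¹) (spectrum ℂ (W : E →L[ℂ] E)) :=
    ContinuousOn.inv₀ (by fun_prop) hsp
  set R : E →L[ℂ] E := cfc (fun t : ℂ => (t - z)⁻¹) (W : E →L[ℂ] E) with hR
  have hWz : cfc (fun t : ℂ => t - z) (W : E →L[ℂ] E) = (W : E →L[ℂ] E) - z • 1 := by
    rw [cfc_sub (fun t : ℂ => t) (fun _ => z) (W : E →L[ℂ] E), cfc_id' ℂ (W : E →L[ℂ] E),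
      cfc_const z (W : E →L[ℂ] E), Algebra.algebraMap_eq_smul_one]
  have hWR : ((W : E →L[ℂ] E) - z • 1) * R = 1 := by
    rw [← hWz, hR, ← cfc_mul _ _ (W : E →L[ℂ] E) (by fun_prop) hci,
      ← cfc_const_one ℂ (W : E →L[ℂ] E)]
    exact cfc_congr fun t ht => mul_inv_cancel₀ (hsp t ht)
  have hRW : R * ((W : E →L[ℂ] E) - z • 1) = 1 := by
    rw [← hWz, hR, ← cfc_mul _ _ (W : E →L[ℂ] E) hci (by fun_prop),
      ← cfc_const_one ℂ (W : E →L[ℂ] E)]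
    exact cfc_congr fun t ht => inv_mul_cancel₀ (hsp t ht)
  have hF0 : cfc (fun t : ℂ => (t + z) / (t - z)) (W : E →L[ℂ] E) = 1 + (2 * z) • R := by
    rw [hR, ← cfc_const_mul (2 * z) _ (W : E →L[ℂ] E) hci, ← cfc_const_one ℂ (W : E →L[ℂ] E),
      ← cfc_add (a := (W : E →L[ℂ] E)) _ _ (by fun_prop) (by fun_prop)]
    refine cfc_congr fun t ht => ?_
    have := hsp t ht
    field_simp
    ring
  set A : E →L[ℂ] E := (W : E →L[ℂ] E) - z • (1 - K.starProjection) with hA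
  have hAu : IsUnit A := by
    refine isUnit_unitary_sub W _ ?_
    rw [norm_smul]
    have h1 : ‖(1 : E →L[ℂ] E) - K.starProjection‖ ≤ 1 := by
      have : (1 : E →L[ℂ] E) - K.starProjection = Kᗮ.starProjection := by
        rw [Submodule.starProjection_orthogonal]; rfl
      rw [this]
      exact Submodule.starProjection_norm_le _
    nlinarith [norm_nonneg z]
  set Q := Ring.inverse A with hQ
  have hAQ : A * Q = 1 := Ring.mul_inverse_cancel A hAu
  have hQA : Q * A = 1 := Ring.inverse_mul_cancel A hAu
  have hAP : A = ((W : E →L[ℂ] E) - z • 1) + z • K.starProjection := by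
    rw [hA, smul_sub]; abel
  have hRQ : R = Q + z • (Q * K.starProjection * R) := by
    have : Q * A * R = Q + z • (Q * K.starProjection * R) := by
      rw [mul_assoc, hAP, add_mul, hWR, mul_add, mul_one, smul_mul_assoc, mul_smul_comm, mul_assoc]
    rw [← this, hQA, one_mul]
  have hRQ' : R = Q + z • (R * K.starProjection * Q) := by
    have : R * A * Q = Q + z • (R * K.starProjection * Q) := by
      rw [hAP, mul_add, hRW, add_mul, one_mul, mul_smul_comm, smul_mul_assoc]
    rw [← this, mul_assoc, hAQ, mul_one]
  have hcm : ∀ X Y : E →L[ℂ] E, compression K (X * K.starProjection * Y) =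
      compression K X * compression K Y := fun X Y => rfl
  have hcadd : ∀ X Y : E →L[ℂ] E, compression K (X + Y) = compression K X + compression K Y :=
    fun X Y => by ext; simp [compression]
  have hcsmul : ∀ (c : ℂ) (X : E →L[ℂ] E), compression K (c • X) = c • compression K X :=
    fun c X => by ext; simp [compression]
  have hc1 : compression K (1 : E →L[ℂ] E) = 1 := by ext; simp [compression]
  set a := compression K Q with ha
  set b := compression K R with hb
  have e1 : b = a + z • (a * b) := by
    conv_lhs => rw [hb, hRQ]
    rw [hcadd, hcsmul, hcm]
  have e2 : b = a + z • (b * a) := by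
    conv_lhs => rw [hb, hRQ']
    rw [hcadd, hcsmul, hcm]
  have hF : caratheodoryFunction W K z = 1 + (2 * z) • b := by
    rw [caratheodoryFunction, hF0, hcadd, hcsmul, hc1]
  have hf : schurFunction W K z = a := rfl
  rw [hf, hF]
  exact schur_algebra a b z hz0 e1 e2

/-- The function `f` on the unit disk has an analytic continuation to a neighbourhood of the point
`z₀` of the unit circle, and the value of the continuation at `z₀` is `a`. -/
def IsContinuedValue {F : Type*} [NormedAddCommGroup F] [NormedSpace ℂ F] (f : ℂ → F) (z₀ : ℂ)
    (a : F) : Prop :=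
  ∃ g : ℂ → F, AnalyticAt ℂ g z₀ ∧ (∀ᶠ z in 𝓝[Metric.ball 0 1] z₀, g z = f z) ∧ g z₀ = a

end

end

/-! ### Invertibility of `W - s(1 - P)` at `s = ±1`, and the graph of the Schur function. -/

section

variable {E : Type*} [NormedAddCommGroup E] [InnerProductSpace ℂ E]

/-! Write `P` for the projection onto the finite-dimensional cyclic space `K`, and `s = ±1`. The
formula defining `f` still makes sense at `s`, because `W - s(1 - P)` is invertible. The gap makes
it a finite-rank perturbation of an invertible operator, so injectivity suffices. A kernel vector
is, by Pythagoras, an eigenvector of `W` orthogonal to `K`, hence zero by cyclicity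
(`isUnit_sub_smul_of_isCyclicFor`).

Everything else is read off the graph (`schurFunction_apply_eq_iff`): `f(s)k = m` iff `W(m + q) = k
+ sq` for some `q ∈ Kᗮ`. Norms show that `f(s)` is isometric. Applying a symmetry, which preserves
both `K` and `Kᗮ`, transports solutions to solutions, exchanging the two sides when `W` becomes
`W*`. Taking `m = sk` shows that `P` maps the `s`-eigenspace of `W` bijectively onto that of `f(s)`
(`eigSpaceEquiv`). Since `P` commutes with the symmetries, dimensions and traces of `γ` agree, and
so do the indices. -/

theorem Sign.smul_smul_self (s : Sign) (x : E) : s.toComplex • s.toComplex • x = x := by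
  rw [smul_smul, s.toComplex_mul_self, one_smul]

theorem Sign.norm_toComplex (s : Sign) : ‖s.toComplex‖ = 1 := by
  cases s <;> simp [Sign.toComplex]

/-- An injective perturbation of an invertible operator by an operator whose range lies in a
finite-dimensional subspace is invertible. -/
theorem isUnit_add_of_injective [CompleteSpace E] {A B : E →L[ℂ] E} (hA : IsUnit A)
    (F : Submodule ℂ E) [FiniteDimensional ℂ F] (hB : ∀ x, B x ∈ F)
    (hinj : ∀ x, (A + B) x = 0 → x = 0) : IsUnit (A + B) := by
  obtain ⟨u, rfl⟩ := hA
  have h1 : ∀ x, (u : E →L[ℂ] E) ((↑u⁻¹ : E →L[ℂ] E) x) = x := fun x => by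
    rw [← mul_apply_eq_comp, Units.mul_inv]; rfl
  have h2 : ∀ x, (↑u⁻¹ : E →L[ℂ] E) ((u : E →L[ℂ] E) x) = x := fun x => by
    rw [← mul_apply_eq_comp, Units.inv_mul]; rfl
  rw [ContinuousLinearMap.isUnit_iff_bijective]
  have hi : Function.Injective ((u : E →L[ℂ] E) + B) :=
    (injective_iff_map_eq_zero _).2 hinj
  refine ⟨hi, fun y => ?_⟩
  -- On `F` the operator `(u + B)u⁻¹ = 1 + Bu⁻¹` is an injective endomorphism, hence surjective by
  -- finite dimension. If `T r = Bu⁻¹y`, then `u⁻¹(y - r)` is a preimage of `y`.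
  let T : F →ₗ[ℂ] F := LinearMap.codRestrict F
    ((((u : E →L[ℂ] E) + B) * (↑u⁻¹ : E →L[ℂ] E) : E →L[ℂ] E).toLinearMap.comp F.subtype)
    fun x => by
      change (u : E →L[ℂ] E) ((↑u⁻¹ : E →L[ℂ] E) x) + B _ ∈ F
      rw [h1]
      exact F.add_mem x.2 (hB _)
  have hT : ∀ x : F, (T x : E) = ((u : E →L[ℂ] E) + B) ((↑u⁻¹ : E →L[ℂ] E) x) := fun x => rfl
  have hTi : Function.Injective T := by
    refine (injective_iff_map_eq_zero T).2 fun x hx => ?_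
    have h3 := hinj _ ((hT x).symm.trans (congrArg Subtype.val hx))
    have h4 := h1 (x : E)
    rw [h3, map_zero] at h4
    exact Subtype.ext h4.symm
  obtain ⟨r, hr⟩ := LinearMap.injective_iff_surjective.1 hTi ⟨B ((↑u⁻¹ : E →L[ℂ] E) y), hB _⟩
  refine ⟨(↑u⁻¹ : E →L[ℂ] E) (y - r), ?_⟩
  rw [map_sub, map_sub, ← hT, hr, add_apply, h1]
  simp

/-- The difference between `A - z` and some invertible operator has range in the eigenspace at an
isolated point `z` of the spectrum of a normal operator `A`. -/
theorem exists_isUnit_sub_of_not_accPt [CompleteSpace E] (A : E →L[ℂ] E) [IsStarNormal A] (z : ℂ)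
    (hz : ¬ AccPt z (Filter.principal (spectrum ℂ A))) :
    ∃ p : E →L[ℂ] E, (∀ x, p x ∈ eigSpace A z) ∧ IsUnit (A - z • 1 + p) := by
  classical
  -- The indicator of `{z}` is continuous on the spectrum because `z` is not an accumulation point,
  -- and `t - z + g(t)` never vanishes. So `cfc g A` is the spectral projection at `z`.
  set g : ℂ → ℂ := fun t => if t = z then 1 else 0 with hg
  have hgc : ContinuousOn g (spectrum ℂ A) := by
    intro t ht
    have : g =ᶠ[𝓝[spectrum ℂ A] t] fun _ => g t := by
      by_cases htz : t = z
      · subst htz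
        rw [accPt_iff_frequently, Filter.not_frequently] at hz
        filter_upwards [mem_nhdsWithin_of_mem_nhds hz, self_mem_nhdsWithin] with y hy hy'
        have : y = t := by_contra fun h => hy ⟨h, hy'⟩
        rw [this]
      · filter_upwards [mem_nhdsWithin_of_mem_nhds (isOpen_ne.mem_nhds htz)] with y hy
        have hy : y ≠ z := hy
        simp [hg, hy, htz]
    exact continuousWithinAt_const.congr_of_eventuallyEq this rfl
  have hAz : cfc (fun t : ℂ => t - z) A = A - z • 1 := by
    rw [cfc_sub (fun t : ℂ => t) (fun _ => z) A, cfc_id' ℂ A, cfc_const z A,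
      Algebra.algebraMap_eq_smul_one]
  refine ⟨cfc g A, fun x => ?_, ?_⟩
  · have h0 : (A - z • 1) * cfc g A = 0 := by
      rw [← hAz, ← cfc_mul _ _ A (by fun_prop) hgc, ← cfc_const_zero ℂ A]
      refine cfc_congr fun t _ => ?_
      by_cases htz : t = z <;> simp [hg, htz]
    have h1 := DFunLike.congr_fun h0 x
    rw [Module.End.mem_eigenspace_iff, ContinuousLinearMap.coe_coe]
    exact sub_eq_zero.1 h1
  · rw [← hAz, ← cfc_add (a := A) _ _ (by fun_prop) hgc]
    refine (isUnit_cfc_iff _ A (by fun_prop)).2 fun t _ => ?_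
    by_cases htz : t = z
    · simp [hg, htz]
    · simp [hg, htz, sub_ne_zero]

/-- The gap condition only constrains points of the spectrum; an accumulation point is one of them
because the spectrum is closed. -/
theorem IsEssentiallyGappedAt.not_accPt [CompleteSpace E] {A : E →L[ℂ] E} {z : ℂ}
    (h : IsEssentiallyGappedAt A z) : ¬ AccPt z (Filter.principal (spectrum ℂ A)) := by
  obtain ⟨r, hr, h⟩ := h
  intro ha
  have hz : z ∈ spectrum ℂ A := by
    have := ha.clusterPt.mem_closure
    rwa [(spectrum.isClosed A).closure_eq] at this
  exact (h z hz (Metric.mem_ball_self hr)).1 ha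

theorem IsEssentiallyGappedAt.finiteDimensional [CompleteSpace E] {A : E →L[ℂ] E} {z : ℂ}
    (h : IsEssentiallyGappedAt A z) : FiniteDimensional ℂ (eigSpace A z) := by
  obtain ⟨r, hr, h⟩ := h
  by_cases hz : z ∈ spectrum ℂ A
  · exact (h z hz (Metric.mem_ball_self hr)).2.2
  · have : eigSpace A z = ⊥ := by
      rw [Submodule.eq_bot_iff]
      intro x hx
      rw [Module.End.mem_eigenspace_iff, ContinuousLinearMap.coe_coe] at hx
      rw [spectrum.notMem_iff, ContinuousLinearMap.isUnit_iff_bijective] at hz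
      refine (injective_iff_map_eq_zero (algebraMap ℂ (E →L[ℂ] E) z - A)).1 hz.1 x ?_
      simp [Algebra.algebraMap_eq_smul_one, hx]
    rw [this]
    infer_instance

variable [CompleteSpace E] (W : unitary (E →L[ℂ] E)) (K : Submodule ℂ E)

/-- An eigenvector of a unitary that is orthogonal to a cyclic subspace vanishes. -/
theorem IsCyclicFor.eq_zero_of_mem_orthogonal {W : unitary (E →L[ℂ] E)} {K : Submodule ℂ E}
    (hcyc : IsCyclicFor W K) (s : Sign) {v : E}
    (hv : (W : E →L[ℂ] E) v = s.toComplex • v) (hK : v ∈ Kᗮ) : v = 0 := by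
  -- Since `s⁻¹ = s`, both `W` and `W⁻¹` multiply `v` by `s`.
  have hpow : ∀ n : ℤ, ∃ c : ℂ, ((W ^ n : unitary (E →L[ℂ] E)) : E →L[ℂ] E) v = c • v := by
    intro n
    induction n using Int.induction_on with
    | zero => exact ⟨1, by simp⟩
    | succ n ih =>
      obtain ⟨c, hc⟩ := ih
      refine ⟨s.toComplex * c, ?_⟩
      rw [zpow_add_one, Submonoid.coe_mul, mul_apply_eq_comp, hv, map_smul, hc,
        smul_smul]
    | pred n ih =>
      obtain ⟨c, hc⟩ := ih
      refine ⟨s.toComplex * c, ?_⟩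
      have : ((W⁻¹ : unitary (E →L[ℂ] E)) : E →L[ℂ] E) v = s.toComplex • v :=
        (star_apply_of_eig W s v).2 hv
      rw [zpow_sub_one, Submonoid.coe_mul, mul_apply_eq_comp, this, map_smul, hc,
        smul_smul]
  -- Unitarity moves `Wⁿ` across: `⟨v, Wⁿk⟩ = ⟨W⁻ⁿv, k⟩`, a multiple of `⟨v, k⟩ = 0`.
  have hle : (⨆ n : ℤ, K.map (((W ^ n : unitary (E →L[ℂ] E)) : E →L[ℂ] E) : E →ₗ[ℂ] E)) ≤
      (Submodule.span ℂ {v})ᗮ := by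
    refine iSup_le fun n => ?_
    rintro _ ⟨k, hk, rfl⟩
    rw [Submodule.mem_orthogonal_singleton_iff_inner_right]
    obtain ⟨c, hc⟩ := hpow (-n)
    have h1 := ContinuousLinearMap.inner_map_map_of_mem_unitary (W ^ (-n)).2 v
      (((W ^ n : unitary (E →L[ℂ] E)) : E →L[ℂ] E) k)
    have h2 : ((W ^ (-n) : unitary (E →L[ℂ] E)) : E →L[ℂ] E)
        (((W ^ n : unitary (E →L[ℂ] E)) : E →L[ℂ] E) k) = k := by
      rw [← mul_apply_eq_comp, ← Submonoid.coe_mul, ← zpow_add, neg_add_cancel,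
        zpow_zero]
      rfl
    rw [h2, hc, inner_smul_left, (Submodule.mem_orthogonal' K v).1 hK k hk, mul_zero] at h1
    exact h1.symm
  have htop := Submodule.topologicalClosure_minimal _ hle (Submodule.isClosed_orthogonal _)
  rw [show _ = _ from hcyc] at htop
  have := htop (Submodule.mem_top (x := v))
  rw [Submodule.mem_orthogonal_singleton_iff_inner_right] at this
  exact inner_self_eq_zero.1 this

/-- The operator inverted in the definition of the Schur function is invertible at `±1` too, if the
unitary is essentially gapped there and the subspace is cyclic. -/
theorem isUnit_sub_smul_of_isCyclicFor [FiniteDimensional ℂ K] (hcyc : IsCyclicFor W K) (s : Sign)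
    (hgap : IsEssentiallyGappedAt (W : E →L[ℂ] E) s.toComplex) :
    IsUnit ((W : E →L[ℂ] E) - s.toComplex • (1 - K.starProjection)) := by
  obtain ⟨p, hp, hu⟩ := exists_isUnit_sub_of_not_accPt (W : E →L[ℂ] E) s.toComplex hgap.not_accPt
  have := hgap.finiteDimensional
  have heq : (W : E →L[ℂ] E) - s.toComplex • (1 - K.starProjection) =
      ((W : E →L[ℂ] E) - s.toComplex • 1 + p) + (s.toComplex • K.starProjection - p) := by
    rw [smul_sub]; abel
  rw [heq]
  refine isUnit_add_of_injective hu (K ⊔ eigSpace (W : E →L[ℂ] E) s.toComplex)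
    (fun x => Submodule.sub_mem _ (Submodule.mem_sup_left ?_) (Submodule.mem_sup_right (hp x)))
    fun x hx => ?_
  · exact K.smul_mem _ (K.starProjection_apply_mem x)
  · rw [← heq] at hx
    -- Taking norms gives `‖x‖ = ‖(1 - P)x‖`, so `Px = 0` and `x` is an eigenvector in `Kᗮ`.
    have h1 : (W : E →L[ℂ] E) x = s.toComplex • (x - K.starProjection x) := sub_eq_zero.1 hx
    have h2 := congrArg norm h1
    rw [ContinuousLinearMap.norm_map_of_mem_unitary W.2, norm_smul, s.norm_toComplex, one_mul,
      ← K.starProjection_orthogonal_val] at h2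
    have h3 := K.norm_sq_eq_add_norm_sq_starProjection x
    rw [← h2] at h3
    have h4 : K.starProjection x = 0 := by
      rw [← norm_eq_zero, ← sq_eq_zero_iff]
      linarith
    rw [h4, sub_zero] at h1
    exact hcyc.eq_zero_of_mem_orthogonal s h1 (K.starProjection_apply_eq_zero_iff.1 h4)

variable [K.HasOrthogonalProjection]

theorem compression_analyticAt {R : ℂ → E →L[ℂ] E} {z : ℂ} (hR : AnalyticAt ℂ R z) :
    AnalyticAt ℂ (fun w => compression K (R w)) z := by
  let C : (E →L[ℂ] E) →L[ℂ] (K →L[ℂ] K) :=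
    (ContinuousLinearMap.compL ℂ K E K K.orthogonalProjectionOnto).comp
      ((ContinuousLinearMap.compL ℂ K E E).flip K.subtypeL)
  have hC : AnalyticAt ℂ C (R z) := by apply ContinuousLinearMap.analyticAt
  exact hC.comp hR

/-- Inversion is analytic at units, and compression is bounded and linear. Nothing here needs `|z| <
1`, so the defining formula serves as its own continuation at `±1`. -/
theorem schurFunction_analyticAt {z : ℂ}
    (hu : IsUnit ((W : E →L[ℂ] E) - z • (1 - K.starProjection))) :
    AnalyticAt ℂ (schurFunction W K) z := by
  have hA : AnalyticAt ℂ (fun w : ℂ => (W : E →L[ℂ] E) - w • (1 - K.starProjection)) z := by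
    fun_prop
  obtain ⟨u, hu⟩ := hu
  have hi : AnalyticAt ℂ Ring.inverse ((W : E →L[ℂ] E) - z • (1 - K.starProjection)) :=
    hu ▸ analyticAt_inverse (𝕜 := ℂ) u
  exact compression_analyticAt K (hi.comp_of_eq
    (f := fun w : ℂ => (W : E →L[ℂ] E) - w • (1 - K.starProjection)) hA rfl)

/-- The graph of a value of the Schur function. -/
theorem schurFunction_apply_eq_iff {z : ℂ}
    (hu : IsUnit ((W : E →L[ℂ] E) - z • (1 - K.starProjection))) (k m : K) :
    schurFunction W K z k = m ↔
      ∃ q ∈ Kᗮ, (W : E →L[ℂ] E) (m + q) = k + z • q := by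
  set A := (W : E →L[ℂ] E) - z • (1 - K.starProjection) with hA
  have h1 : ∀ x, A (Ring.inverse A x) = x := fun x => by
    rw [← mul_apply_eq_comp, Ring.mul_inverse_cancel A hu]; rfl
  have h2 : ∀ x, Ring.inverse A (A x) = x := fun x => by
    rw [← mul_apply_eq_comp, Ring.inverse_mul_cancel A hu]; rfl
  have hAx : ∀ x, A x = (W : E →L[ℂ] E) x - z • (x - K.starProjection x) := fun x => rfl
  change K.orthogonalProjectionOnto (Ring.inverse A k) = m ↔ _
  constructor
  · intro h
    -- With `x = A⁻¹k`, the vectors `m` and `q` are the components of `x` in `K` and `Kᗮ`.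
    refine ⟨Ring.inverse A k - K.starProjection (Ring.inverse A k),
      K.sub_starProjection_mem_orthogonal _, ?_⟩
    rw [← h, ← K.starProjection_apply, add_sub_cancel, ← sub_eq_iff_eq_add, ← hAx, h1]
  · rintro ⟨q, hq, h⟩
    have h3 : K.starProjection (m + q) = m := by
      rw [map_add, K.starProjection_mem_subspace_eq_self,
        K.starProjection_apply_eq_zero_iff.2 hq, add_zero]
    have h4 : A (m + q) = k := by rw [hAx, h3, h]; simp
    rw [← h4, h2]
    exact Subtype.ext (by rw [← K.starProjection_apply, h3])

end

/-! ### Symmetries and eigenspaces of the value at `±1`. -/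

section

variable {E : Type*} [NormedAddCommGroup E] [InnerProductSpace ℂ E]

/-- An antilinear or linear isometry that restricts to a bijection of a subspace maps its orthogonal
complement to itself. -/
theorem map_mem_orthogonal {φ : ℂ →+* ℂ} [RingHomInvPair φ φ] (σ : E ≃ₛₗᵢ[φ] E)
    {K : Submodule ℂ E} (σK : K ≃ₛₗᵢ[φ] K) (hσK : ∀ k, (σK k : E) = σ k) {q : E} (hq : q ∈ Kᗮ) :
    σ q ∈ Kᗮ := by
  -- Polarization expresses the real part through norms alone, which treats linear and antilinear
  -- `σ` alike. Replacing `k` by `ik` then gives the imaginary part.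
  have hre : ∀ k ∈ K, RCLike.re (inner ℂ k (σ q)) = (0 : ℝ) := by
    intro k hk
    obtain ⟨k', hk'⟩ := σK.surjective ⟨k, hk⟩
    have h1 : k = σ k' := by rw [← hσK, hk']
    rw [re_inner_eq_norm_add_mul_self_sub_norm_mul_self_sub_norm_mul_self_div_two, h1, ← map_add,
      σ.norm_map, σ.norm_map, σ.norm_map,
      ← re_inner_eq_norm_add_mul_self_sub_norm_mul_self_sub_norm_mul_self_div_two (𝕜 := ℂ),
      (K.mem_orthogonal q).1 hq k' k'.2]
    simp
  rw [Submodule.mem_orthogonal]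
  intro k hk
  have h1 := hre k hk
  have h2 := hre (Complex.I • k) (K.smul_mem _ hk)
  rw [inner_smul_left] at h2
  apply Complex.ext
  · exact h1
  · simpa using h2

theorem orthogonalProjectionOnto_map {φ : ℂ →+* ℂ} [RingHomInvPair φ φ] (σ : E ≃ₛₗᵢ[φ] E)
    {K : Submodule ℂ E} [K.HasOrthogonalProjection] (σK : K ≃ₛₗᵢ[φ] K) (hσK : ∀ k, (σK k : E) = σ k)
    (x : E) :
    K.orthogonalProjectionOnto (σ x) = σK (K.orthogonalProjectionOnto x) := by
  refine Subtype.ext ?_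
  rw [← K.starProjection_apply, hσK, ← K.starProjection_apply]
  refine (K.eq_starProjection_of_mem_orthogonal ?_ ?_)
  · rw [K.starProjection_apply, ← hσK]
    exact (σK _).2
  · rw [← map_sub]
    exact map_mem_orthogonal σ σK hσK (K.sub_starProjection_mem_orthogonal x)

variable [CompleteSpace E] {W : unitary (E →L[ℂ] E)} {K : Submodule ℂ E} {s : Sign} {f : K →L[ℂ] K}

/-- `f` is the value at `s` of the Schur function of `K`, in terms of its graph. -/
def IsSchurGraph (W : unitary (E →L[ℂ] E)) (K : Submodule ℂ E) (s : Sign) (f : K →L[ℂ] K) : Prop :=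
  ∀ k m : K, f k = m ↔ ∃ q ∈ Kᗮ, (W : E →L[ℂ] E) (m + q) = k + s.toComplex • q

namespace IsSchurGraph

/-- `W` is isometric and `|s| = 1`, so Pythagoras on both sides of the graph equation leaves `‖q‖²`
to cancel. -/
theorem norm_map (hf : IsSchurGraph W K s f) (k : K) : ‖f k‖ = ‖k‖ := by
  obtain ⟨q, hq, h⟩ := (hf k (f k)).1 rfl
  have h1 := congrArg (fun x => ‖x‖ * ‖x‖) h
  simp only [ContinuousLinearMap.norm_map_of_mem_unitary W.2] at h1
  rw [norm_add_sq_eq_norm_sq_add_norm_sq_of_inner_eq_zero (𝕜 := ℂ) _ _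
      ((K.mem_orthogonal q).1 hq _ (f k).2),
    norm_add_sq_eq_norm_sq_add_norm_sq_of_inner_eq_zero (𝕜 := ℂ) _ _
      ((K.mem_orthogonal _).1 (Kᗮ.smul_mem _ hq) _ k.2),
    norm_smul, s.norm_toComplex, one_mul, add_left_inj, mul_self_inj (norm_nonneg _)
      (norm_nonneg _)] at h1
  exact h1

theorem mem_unitary [FiniteDimensional ℂ K] (hf : IsSchurGraph W K s f) :
    f ∈ unitary (K →L[ℂ] K) := by
  have hi : Function.Injective f := (injective_iff_map_eq_zero f).2 fun k hk => by
    rw [← norm_eq_zero, ← hf.norm_map, hk, norm_zero]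
  have hu : IsUnit f := ContinuousLinearMap.isUnit_iff_bijective.2
    ⟨hi, (LinearMap.injective_iff_surjective (f := (f : K →ₗ[ℂ] K))).1 hi⟩
  exact hu.mem_unitary_of_star_mul_self
    ((ContinuousLinearMap.norm_map_iff_adjoint_comp_self f).1 hf.norm_map)

/-- Applying `σ` to the graph equation gives another one, with `σq` in place of `q`; `hφ` lets `s`
pass through an antilinear `σ`. -/
theorem conj_eq (hf : IsSchurGraph W K s f) {φ : ℂ →+* ℂ} [RingHomInvPair φ φ]
    (hφ : φ s.toComplex = s.toComplex) (σ : E ≃ₛₗᵢ[φ] E) (σK : K ≃ₛₗᵢ[φ] K)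
    (hσK : ∀ k, (σK k : E) = σ k)
    (hσ : ∀ x, σ ((W : E →L[ℂ] E) (σ.symm x)) = (W : E →L[ℂ] E) x) (x : K) :
    σK (f (σK.symm x)) = f x := by
  obtain ⟨q, hq, h⟩ := (hf (σK.symm x) _).1 rfl
  refine ((hf _ _).2 ⟨σ q, map_mem_orthogonal σ σK hσK hq, ?_⟩).symm
  rw [hσK, ← map_add, ← hσ, σ.symm_apply_apply, h, map_add, ← hσK, σK.apply_symm_apply,
    map_smulₛₗ, hφ]

theorem conj_eq_star [FiniteDimensional ℂ K] (hf : IsSchurGraph W K s f)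
    {φ : ℂ →+* ℂ} [RingHomInvPair φ φ]
    (hφ : φ s.toComplex = s.toComplex) (σ : E ≃ₛₗᵢ[φ] E) (σK : K ≃ₛₗᵢ[φ] K)
    (hσK : ∀ k, (σK k : E) = σ k)
    (hσ : ∀ x, σ ((W : E →L[ℂ] E) (σ.symm x)) = star (W : E →L[ℂ] E) x) (x : K) :
    σK (f (σK.symm x)) = star f x := by
  obtain ⟨q, hq, h⟩ := (hf (σK.symm x) _).1 rfl
  -- From `W(m + q) = k + sq` follows `W*(σm + σq) = σk + sσq`, hence `W(σk + sσq) = σm + s(sσq)`.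
  -- Input and output are exchanged, with `sσq` as the new vector of `Kᗮ`.
  have h1 : f (σK (f (σK.symm x))) = x := by
    refine (hf _ _).2 ⟨s.toComplex • σ q,
      Kᗮ.smul_mem _ (map_mem_orthogonal σ σK hσK hq), ?_⟩
    have h2 := hσ (σ (f (σK.symm x) + q))
    rw [σ.symm_apply_apply, h, map_add, ← hσK, σK.apply_symm_apply, map_smulₛₗ, hφ] at h2
    rw [h2, ← mul_apply_eq_comp, Unitary.mul_star_self_of_mem W.2, s.smul_smul_self, hσK,
      ← map_add]
    rfl
  conv_rhs => rw [← h1]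
  rw [← mul_apply_eq_comp, Unitary.star_mul_self_of_mem hf.mem_unitary]
  rfl

theorem isSymmetryOf [FiniteDimensional ℂ K] {V : unitary (K →L[ℂ] K)}
    (hV : IsSchurGraph W K s (V : K →L[ℂ] K))
    {S : SymType} (ρ : SymRep E S) (hρ : ρ.IsSymmetryOf W) (hK : ρ.Invariant K) :
    (ρ.restrict K hK).IsSymmetryOf V := by
  cases ρ with
  | trivial => exact True.intro
  | particleHole _ η _ => exact hV.conj_eq s.conj_toComplex η _ (fun _ => rfl) hρ
  | timeReversal _ τ _ => exact hV.conj_eq_star s.conj_toComplex τ _ (fun _ => rfl) hρ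
  | chiral γ _ => exact hV.conj_eq_star rfl γ _ (fun _ => rfl) hρ
  | full _ _ η τ _ _ _ =>
    exact ⟨hV.conj_eq s.conj_toComplex η _ (fun _ => rfl) hρ.1,
      hV.conj_eq_star s.conj_toComplex τ _ (fun _ => rfl) hρ.2.1,
      hV.conj_eq_star rfl (τ.trans η : E ≃ₗᵢ[ℂ] E) _ (fun _ => rfl) hρ.2.2⟩

theorem projection_mem_eigSpace [K.HasOrthogonalProjection] (hf : IsSchurGraph W K s f) {v : E}
    (hv : v ∈ eigSpace (W : E →L[ℂ] E) s.toComplex) :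
    K.orthogonalProjectionOnto v ∈ eigSpace f s.toComplex := by
  rw [Module.End.mem_eigenspace_iff, ContinuousLinearMap.coe_coe] at hv ⊢
  -- For `q = s(1 - P)v` the graph equation with `m = sPv` and `k = Pv` reads `W(sv) = v`.
  refine (hf _ _).2 ⟨s.toComplex • (v - K.starProjection v),
    Kᗮ.smul_mem _ (K.sub_starProjection_mem_orthogonal v), ?_⟩
  rw [Submodule.coe_smul, ← K.starProjection_apply, ← smul_add, add_sub_cancel, map_smul, hv,
    s.smul_smul_self, s.smul_smul_self, add_sub_cancel]

/-- The orthogonal projection onto a cyclic subspace is a bijection between the eigenspaces at `±1`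
of a unitary and of its Schur function. -/
noncomputable def eigSpaceEquiv [K.HasOrthogonalProjection] (hf : IsSchurGraph W K s f)
    (hcyc : IsCyclicFor W K) :
    eigSpace (W : E →L[ℂ] E) s.toComplex ≃ₗ[ℂ] eigSpace f s.toComplex :=
  LinearEquiv.ofBijective
    ((K.orthogonalProjectionOnto : E →ₗ[ℂ] K).restrict fun _ => hf.projection_mem_eigSpace) <| by
    constructor
    · refine (injective_iff_map_eq_zero _).2 fun v hv => Subtype.ext ?_
      exact hcyc.eq_zero_of_mem_orthogonal s (Module.End.mem_eigenspace_iff.1 v.2)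
        (K.orthogonalProjectionOnto_eq_zero_iff.1 (congrArg Subtype.val hv))
    · rintro ⟨k, hk⟩
      rw [Module.End.mem_eigenspace_iff, ContinuousLinearMap.coe_coe] at hk
      obtain ⟨q, hq, h⟩ := (hf _ _).1 hk
      -- The graph equation `W(sk + q) = k + sq` is an eigenvalue equation, since `k + sq = s(sk +
      -- q)`.
      refine ⟨⟨k + s.toComplex • q, ?_⟩, Subtype.ext ?_⟩
      · have hv : (k : E) + s.toComplex • q =
            s.toComplex • ((s.toComplex • k : K) + q : E) := by
          rw [smul_add, Submodule.coe_smul, s.smul_smul_self]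
        rw [Module.End.mem_eigenspace_iff, ContinuousLinearMap.coe_coe]
        conv_lhs => rw [hv, map_smul, h]
      · change K.orthogonalProjectionOnto (k + s.toComplex • q) = k
        rw [map_add, K.orthogonalProjectionOnto_mem_subspace_eq_self,
          K.orthogonalProjectionOnto_apply_of_mem_orthogonal (Kᗮ.smul_mem _ hq), add_zero]

end IsSchurGraph

/-- `e` is the restriction of `P`, so it intertwines the induced symmetries. A linear isomorphism
preserves dimension, and an intertwining one preserves the trace of `γ`. -/
theorem siPM_eq_of_isSchurGraph [FiniteDimensional ℂ K] {V : unitary (K →L[ℂ] K)}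
    (hV : IsSchurGraph W K s (V : K →L[ℂ] K)) (hcyc : IsCyclicFor W K) {S : SymType}
    (ρ : SymRep E S) (hρ : ρ.IsSymmetryOf W) (hK : ρ.Invariant K)
    (hρK : (ρ.restrict K hK).IsSymmetryOf V) :
    siPM ρ W hρ s = siPM (ρ.restrict K hK) V hρK s := by
  let e := hV.eigSpaceEquiv hcyc
  have htr : ∀ (T : eigSpace (W : E →L[ℂ] E) s.toComplex →ₗ[ℂ] eigSpace (W : E →L[ℂ] E) s.toComplex)
      (T' : eigSpace (V : K →L[ℂ] K) s.toComplex →ₗ[ℂ] eigSpace (V : K →L[ℂ] K) s.toComplex),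
      (∀ x, e (T x) = T' (e x)) → LinearMap.trace ℂ _ T = LinearMap.trace ℂ _ T' := by
    intro T T' h
    rw [← LinearMap.trace_conj' T e]
    congr 1
    ext x : 1
    rw [LinearEquiv.conj_apply_apply, h, e.apply_symm_apply]
  have htr' : ∀ (η τ : E ≃ₗᵢ⋆[ℂ] E) (ηK τK : K ≃ₗᵢ⋆[ℂ] K) (_ : ∀ k, (ηK k : E) = η k)
      (_ : ∀ k, (τK k : E) = τ k) (x : E),
      K.orthogonalProjectionOnto (η (τ x)) = ηK (τK (K.orthogonalProjectionOnto x)) :=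
    fun η τ ηK τK hη hτ x => by
      rw [orthogonalProjectionOnto_map η ηK hη, orthogonalProjectionOnto_map τ τK hτ]
  cases ρ with
  | trivial => rfl
  | particleHole ε η _ =>
    cases ε
    · exact congrArg (Nat.cast : ℕ → ZMod 2) e.finrank_eq
    · rfl
  | timeReversal => rfl
  | chiral γ _ =>
    exact htr _ _ fun x => Subtype.ext (orthogonalProjectionOnto_map γ _ (fun _ => rfl) (x : E))
  | full ε ε' η τ _ _ _ =>
    cases ε <;> cases ε'
    · exact htr _ _ fun x => Subtype.ext (htr' η τ _ _ (fun _ => rfl) (fun _ => rfl) (x : E))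
    · exact congrArg (Nat.cast : ℕ → ZMod 4) e.finrank_eq
    · rfl
    · exact htr _ _ fun x => Subtype.ext (htr' η τ _ _ (fun _ => rfl) (fun _ => rfl) (x : E))

end

/-! ### The main theorem. -/

theorem mainTheorem1 {H : Type*} [NormedAddCommGroup H] [InnerProductSpace ℂ H] [CompleteSpace H]
    {S : SymType} (ρ : SymRep H S) (W : unitary (H →L[ℂ] H)) (hW : IsAdmissible ρ W)
    (HC : Submodule ℂ H) [FiniteDimensional ℂ HC] (hC : ρ.Invariant HC)
    (hcyc : IsCyclicFor W HC) (s : Sign) :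
    ∃ fs : unitary (HC →L[ℂ] HC),
      IsContinuedValue (schurFunction W HC) s.toComplex (fs : HC →L[ℂ] HC) ∧
      (IsEigenvalue (W : H →L[ℂ] H) s.toComplex ↔
        IsEigenvalue (fs : HC →L[ℂ] HC) s.toComplex) ∧
      ∃ hfs : (ρ.restrict HC hC).IsSymmetryOf fs,
        siPM ρ W hW.symmetric s = siPM (ρ.restrict HC hC) fs hfs s := by
  have hu := isUnit_sub_smul_of_isCyclicFor W HC hcyc s (hW.gapped s)
  have hg : IsSchurGraph W HC s (schurFunction W HC s.toComplex) :=
    schurFunction_apply_eq_iff W HC hu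
  refine ⟨⟨_, hg.mem_unitary⟩,
    ⟨_, schurFunction_analyticAt W HC hu, Filter.Eventually.of_forall fun _ => rfl, rfl⟩, ?_,
    hg.isSymmetryOf (V := ⟨_, hg.mem_unitary⟩) ρ hW.symmetric hC,
    siPM_eq_of_isSchurGraph (V := ⟨_, hg.mem_unitary⟩) hg hcyc ρ hW.symmetric hC _⟩
  have e := hg.eigSpaceEquiv hcyc
  rw [IsEigenvalue, IsEigenvalue, Module.End.hasEigenvalue_iff, Module.End.hasEigenvalue_iff,
    ← Submodule.nontrivial_iff_ne_bot, ← Submodule.nontrivial_iff_ne_bot]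
  exact e.toEquiv.nontrivial_congr
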